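/- Let $K$ be a field, $d\ge 1$ an integer, $S=K[t_0,\dots,t_d]$, and let $P\subset S$ be the ideal of the rational normal curve in $\mathbf P^d$, i.e. the kernel of the $K$-algebra map $S\to K[x,y]$, $t_i\mapsto x^{d-i}y^i$. A monomial initial ideal of $P$ is an ideal $\operatorname{in}_\tau(P)$ with $\tau$ a term order. Let $A=(A_0,\dots,A_d)$ be variables. For a monomial initial ideal $I$ of $P$ put: * $e_0^I=A_{i_0}(i_1-i_0)+\sum_{t=1}^{k-1}A_{i_t}(i_{t+1}-i_{t-1})+A_{i_k}(i_k-i_{k-1})\in\mathbf Z[A]$, where $i_0<i_1<\dots<i_k$ are the indices $j$ with $t_j\notin\sqrt I$; * $H^I(z)=\sum_{i=0}^d A_i\,\frac{\partial H_{S/I}}{\partial t_i}\big|_{t_0=\dots=t_d=z}\in\mathbf Z[A][[z]]$, where $H_{S/I}=\sum_{t^\alpha\notin I}t^\alpha$ is the $\mathbf Z^{d+1}$-graded Hilbert series of $S/I$; * $h^I\in\mathbf Z[A][z]$, the polynomial with $H^I(z)=h^I/(1-z)^3$; * $Q_1^I\in\mathbf Q[A][z]$, the polynomial whose value at $z=k$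 is, for all large integers $k$, the coefficient of $z^k$ in $H^I(z)$. Let $I,J$ be monomial initial ideals of $P$. Then the polynomials $h^I,h^J,Q_1^I,Q_1^J$ exist and are unique, and 1. $e_0^I=e_0^J$ if and only if $\sqrt I=\sqrt J$; 2. $h^I=h^J$ if and only if $I=J$; 3. $Q_1^I=Q_1^J$ if and only if $I$ and $J$ have the same saturation with respect to $(t_0,\dots,t_d)$; equivalently, if and only if $I$ and $J$ coincide from a certain degree on. -/

import Mathlib

noncomputable section

open MvPolynomial

namespace RNC

/-- The ideal `P` of the rational normal curve in projective `d`-space: the kernel of the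
`K`-algebra map `K[t_0, ..., t_d] → K[x, y]`, `t_i ↦ x ^ (d - i) * y ^ i`
(here `x = X 0`, `y = X 1`, and `i ≤ d`, so that the subtraction is a true one). -/
def rationalNormalCurveIdeal (K : Type*) [Field K] (d : ℕ) :
    Ideal (MvPolynomial (Fin (d + 1)) K) :=
  RingHom.ker (aeval (fun i : Fin (d + 1) =>
    (X 0 ^ (d - (i : ℕ)) * X 1 ^ (i : ℕ) : MvPolynomial (Fin 2) K)))

/-- The initial ideal `in_τ(P)` of an ideal with respect to a term order: the ideal generated by
the leading terms of the elements of `P`. -/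
def initialIdeal {K : Type*} [Field K] {n : ℕ} (τ : MonomialOrder.{0, 0} (Fin n))
    (P : Ideal (MvPolynomial (Fin n) K)) : Ideal (MvPolynomial (Fin n) K) :=
  Ideal.span {g | ∃ f ∈ P, f ≠ 0 ∧ g = τ.leadingTerm f}

/-- `I` is a monomial initial ideal of `P`: it is `in_τ(P)` for some term order `τ`. -/
def IsMonomialInitialIdeal {K : Type*} [Field K] {n : ℕ}
    (P I : Ideal (MvPolynomial (Fin n) K)) : Prop :=
  ∃ τ : MonomialOrder.{0, 0} (Fin n), I = initialIdeal τ P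

/-! ### The linear form `e_0^I` -/

open Classical in
/-- The set `{i_0 < i_1 < ... < i_k}` of the indices `j` with `t_j ∉ √I`. -/
def radicalIndices {K : Type*} [Field K] {n : ℕ} (I : Ideal (MvPolynomial (Fin n) K)) :
    Finset (Fin n) :=
  Finset.univ.filter fun j => X j ∉ I.radical

/-- The element of `s` that follows `j`, or `j` itself if there is none. -/
def succIn {n : ℕ} (s : Finset (Fin n)) (j : Fin n) : Fin n :=
  if h : (s.filter fun l => j < l).Nonempty then (s.filter fun l => j < l).min' h else j

/-- The element of `s` that precedes `j`, or `j` itself if there is none. -/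
def predIn {n : ℕ} (s : Finset (Fin n)) (j : Fin n) : Fin n :=
  if h : (s.filter fun l => l < j).Nonempty then (s.filter fun l => l < j).max' h else j

/-- The linear form
`A_{i_0} (i_1 - i_0) + ∑_{0 < t < k} A_{i_t} (i_{t+1} - i_{t-1}) + A_{i_k} (i_k - i_{k-1})`
in the variables `A_0, ..., A_d`, where `i_0 < ... < i_k` are the indices `j` with `t_j ∉ √I`.
At the two ends `i_0` and `i_k`, the missing neighbour is replaced by the index itself. -/
def e0 {K : Type*} [Field K] {n : ℕ} (I : Ideal (MvPolynomial (Fin n) K)) :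
    MvPolynomial (Fin n) ℤ :=
  ∑ j ∈ radicalIndices I,
    C (((succIn (radicalIndices I) j : ℕ) : ℤ) - ((predIn (radicalIndices I) j : ℕ) : ℤ)) * X j

/-! ### The polynomials `h^I` and `Q_1^I` -/

open Classical in
/-- The `ℤ^n`-graded Hilbert series `∑_{t^α ∉ I} t^α` of `S/I`, for a monomial ideal `I`. -/
def multigradedHilbertSeries {K : Type*} [Field K] {n : ℕ}
    (I : Ideal (MvPolynomial (Fin n) K)) : MvPowerSeries (Fin n) ℤ :=
  fun α => if monomial α (1 : K) ∈ I then 0 else 1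

/-- The specialization `t_0 = ... = t_d = z` of a power series in the variables `t_i`. -/
def diagonal {n : ℕ} (f : MvPowerSeries (Fin n) ℤ) : PowerSeries ℤ :=
  PowerSeries.mk fun k => ∑ α ∈ Finset.univ.finsuppAntidiag k, MvPowerSeries.coeff α f

/-- The power series `A · (∇ H_{S/I})_{t_i = z} = ∑_i A_i (∂ H_{S/I} / ∂ t_i)_{t_i = z}` in `z`,
with coefficients in `ℤ[A_0, ..., A_d]`. Its value at `A = a` is the Hilbert series
`∑_k dim (R / L^{k+1}) z^k` for the lex-segment ideals `L` of `R = K[x, y]` whose sequence `a`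
lies in the cone of `I`. -/
def hilbertOneSeries {K : Type*} [Field K] {n : ℕ} (I : Ideal (MvPolynomial (Fin n) K)) :
    PowerSeries (MvPolynomial (Fin n) ℤ) :=
  ∑ i : Fin n, PowerSeries.C (X i) *
    PowerSeries.map (C : ℤ →+* MvPolynomial (Fin n) ℤ)
      (diagonal (MvPowerSeries.pderiv ℤ i (multigradedHilbertSeries I)))

/-- `h` is the polynomial `h^I ∈ ℤ[A][z]`, the numerator in
`A · (∇ H_{S/I})_{t_i = z} = h^I / (1 - z)^3`. -/
def IsHPolynomial {K : Type*} [Field K] {n : ℕ} (I : Ideal (MvPolynomial (Fin n) K))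
    (h : Polynomial (MvPolynomial (Fin n) ℤ)) : Prop :=
  (h : PowerSeries (MvPolynomial (Fin n) ℤ)) = (1 - PowerSeries.X) ^ 3 * hilbertOneSeries I

/-- `Q` is the Hilbert polynomial `Q_1^I ∈ ℚ[A][z]`: for all large `k`, its value at `z = k` is the
coefficient of `z^k` in `A · (∇ H_{S/I})_{t_i = z}`. -/
def IsHilbertPolynomialOne {K : Type*} [Field K] {n : ℕ} (I : Ideal (MvPolynomial (Fin n) K))
    (Q : Polynomial (MvPolynomial (Fin n) ℚ)) : Prop :=
  ∃ N : ℕ, ∀ k : ℕ, N ≤ k →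
    Q.eval (k : MvPolynomial (Fin n) ℚ) =
      MvPolynomial.map (Int.castRingHom ℚ) (PowerSeries.coeff k (hilbertOneSeries I))

/-! ### Saturation -/

/-- The saturation `⋃_r (I : 𝔪^r)` of `I`, where `𝔪 = (t_0, ..., t_d)`. -/
def saturation {K : Type*} [Field K] {n : ℕ} (I : Ideal (MvPolynomial (Fin n) K)) :
    Ideal (MvPolynomial (Fin n) K) :=
  ⨆ r : ℕ, Submodule.colon I
    ((Ideal.span (Set.range X) ^ r : Ideal (MvPolynomial (Fin n) K)) :
      Set (MvPolynomial (Fin n) K))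

/-- `I` and `J` coincide from a certain degree on. -/
def AgreeInLargeDegrees {K : Type*} [Field K] {n : ℕ}
    (I J : Ideal (MvPolynomial (Fin n) K)) : Prop :=
  ∃ N : ℕ, ∀ k : ℕ, N ≤ k → ∀ f : MvPolynomial (Fin n) K, f.IsHomogeneous k → (f ∈ I ↔ f ∈ J)

end RNC

end

/-! ### Initial ideals and the monomials they contain -/

noncomputable section

open MvPolynomial

namespace RNC

/-! Since `P` is toric, everything is read off the fibres of `bidegree`, the map sending an exponent
to that of its image in `K[x, y]`. A monomial lies outside `in_τ(P)` exactly when it is the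
`τ`-least one of its fibre (`monomial_notMem_initialIdeal_iff`), so each nonempty fibre contains
exactly one standard monomial.

For `h` and `Q_1`: the coefficient of `z^k` in `H^I` records the vector sum of all standard
exponents of degree `k + 1`. Two initial ideals pick one exponent from each of the same fibres, and
those picked by `I` are least for its order. If the two sums agree, an inequality that holds term by
term becomes an equality, so the picks agree (`IsMonomialInitialIdeal.standardExponents_eq`).
Equality of the series in all degrees gives `I = J`; equality in large degrees gives equal
saturations.

For `e_0`: let `R` be the set of `j` with `t_j ∉ √I`. For `a ≤ b` in `R`, `t_a t_b ∉ √I` if and only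
if no element of `R` lies strictly between (`X_mul_X_mem_radical`, `X_mul_X_notMem_radical`). So `R`
determines `√I`, and `R` is the support of `e_0`.

For existence: by the same betweenness relation, at most two exponents of a standard monomial can
grow without bound, so the coefficients are eventually quadratic in the degree. -/

/-- `I` is generated by monomials. -/
def IsMonomialIdeal {K : Type*} [Field K] {n : ℕ} (I : Ideal (MvPolynomial (Fin n) K)) : Prop :=
  ∃ s : Set (Fin n →₀ ℕ), I = Ideal.span ((fun α => monomial α (1 : K)) '' s)

theorem initialIdeal_eq_span {K : Type*} [Field K] {n : ℕ} (τ : MonomialOrder.{0, 0} (Fin n))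
    (P : Ideal (MvPolynomial (Fin n) K)) :
    initialIdeal τ P = Ideal.span ((fun α => monomial α (1 : K)) ''
      {α | ∃ f ∈ P, f ≠ 0 ∧ τ.degree f = α}) := by
  have h := τ.span_leadingTerm_eq_span_monomial' (B := (P : Set (MvPolynomial (Fin n) K)) \ {0})
  have h1 : {g | ∃ f ∈ P, f ≠ 0 ∧ g = τ.leadingTerm f} =
      τ.leadingTerm '' ((P : Set (MvPolynomial (Fin n) K)) \ {0}) := by
    ext g
    constructor
    · rintro ⟨f, hf, h0, rfl⟩
      exact ⟨f, ⟨hf, h0⟩, rfl⟩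
    · rintro ⟨f, ⟨hf, h0⟩, rfl⟩
      exact ⟨f, hf, h0, rfl⟩
  rw [initialIdeal, h1, h]
  congr 1
  ext g
  constructor
  · rintro ⟨f, ⟨⟨hf, h0⟩, -⟩, rfl⟩
    exact ⟨_, ⟨f, hf, h0, rfl⟩, rfl⟩
  · rintro ⟨_, ⟨f, hf, h0, rfl⟩, rfl⟩
    exact ⟨f, ⟨⟨hf, h0⟩, h0⟩, rfl⟩

theorem IsMonomialInitialIdeal.isMonomialIdeal {K : Type*} [Field K] {n : ℕ}
    {P I : Ideal (MvPolynomial (Fin n) K)} (h : IsMonomialInitialIdeal P I) :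
    IsMonomialIdeal I := by
  obtain ⟨τ, rfl⟩ := h
  exact ⟨_, initialIdeal_eq_span τ P⟩

theorem monomial_mem_initialIdeal_iff {K : Type*} [Field K] {n : ℕ}
    (τ : MonomialOrder.{0, 0} (Fin n)) (P : Ideal (MvPolynomial (Fin n) K)) (α : Fin n →₀ ℕ) :
    monomial α (1 : K) ∈ initialIdeal τ P ↔ ∃ f ∈ P, f ≠ 0 ∧ τ.degree f = α := by
  classical
  rw [initialIdeal_eq_span, mem_ideal_span_monomial_image]
  simp only [support_monomial, one_ne_zero, if_false, Finset.mem_singleton, forall_eq,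
    Set.mem_ofPred_eq]
  constructor
  · rintro ⟨β, ⟨f, hf, h0, rfl⟩, hle⟩
    have hne : monomial (α - τ.degree f) (1 : K) ≠ 0 := by simp
    refine ⟨monomial (α - τ.degree f) 1 * f, P.mul_mem_left _ hf, mul_ne_zero hne h0, ?_⟩
    rw [τ.degree_mul hne h0, τ.degree_monomial, if_neg one_ne_zero]
    exact tsub_add_cancel_of_le hle
  · rintro ⟨f, hf, h0, rfl⟩
    exact ⟨_, ⟨f, hf, h0, rfl⟩, le_rfl⟩

/-! ### Monomial ideals: truncation of exponents and saturation -/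

section MonomialIdeal

variable {K : Type*} [Field K] {n : ℕ} {I J : Ideal (MvPolynomial (Fin n) K)}

theorem monomial_mem_of_le {α β : Fin n →₀ ℕ} (h : monomial α (1 : K) ∈ I) (hle : α ≤ β) :
    monomial β (1 : K) ∈ I := by
  rw [← tsub_add_cancel_of_le hle, ← one_mul (1 : K), ← monomial_mul]
  exact I.mul_mem_left _ h

theorem IsMonomialIdeal.mem_iff (hI : IsMonomialIdeal I) (f : MvPolynomial (Fin n) K) :
    f ∈ I ↔ ∀ α ∈ f.support, monomial α (1 : K) ∈ I := by
  classical
  obtain ⟨s, rfl⟩ := hI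
  simp only [mem_ideal_span_monomial_image, support_monomial, one_ne_zero, if_false,
    Finset.mem_singleton, forall_eq]

theorem IsMonomialIdeal.ext (hI : IsMonomialIdeal I) (hJ : IsMonomialIdeal J)
    (h : ∀ α, monomial α (1 : K) ∈ I ↔ monomial α (1 : K) ∈ J) : I = J := by
  ext f
  rw [hI.mem_iff, hJ.mem_iff]
  simp only [h]

/-- The exponent obtained from `α` by replacing all entries greater than `M` by `M`. -/
def truncate (M : ℕ) (α : Fin n →₀ ℕ) : Fin n →₀ ℕ :=
  Finsupp.equivFunOnFinite.symm fun i => min (α i) M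

@[simp]
theorem truncate_apply (M : ℕ) (α : Fin n →₀ ℕ) (i : Fin n) : truncate M α i = min (α i) M := rfl

/-- Finitely many monomials generate, so any `M` bounding all their exponents works: divisibility by
a generator cannot see entries beyond `M`. -/
theorem IsMonomialIdeal.exists_truncate (hI : IsMonomialIdeal I) :
    ∃ M, ∀ α, monomial α (1 : K) ∈ I ↔ monomial (truncate M α) (1 : K) ∈ I := by
  classical
  obtain ⟨s, rfl⟩ := hI
  obtain ⟨t, hts, ht⟩ := (Submodule.fg_span_iff_fg_span_finset_subset _).1
    (IsNoetherian.noetherian (Ideal.span ((fun α => monomial α (1 : K)) '' s)))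
  obtain ⟨u, hus, rfl⟩ := Finset.subset_set_image_iff.1 hts
  rw [Finset.coe_image] at ht
  change Ideal.span _ = Ideal.span _ at ht
  rw [ht]
  -- The double sum is a crude upper bound for every entry of every generator.
  refine ⟨∑ β ∈ u, ∑ i, β i, fun α => ?_⟩
  refine ⟨fun h => ?_, fun h => monomial_mem_of_le h fun i => by simp⟩
  simp only [mem_ideal_span_monomial_image, support_monomial, one_ne_zero, if_false,
    Finset.mem_singleton, forall_eq] at h ⊢
  obtain ⟨β, hβ, hle⟩ := h
  refine ⟨β, hβ, fun i => le_min (hle i) ?_⟩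
  calc β i ≤ ∑ i, β i := Finset.single_le_sum (f := fun i => β i) (by simp) (Finset.mem_univ i)
    _ ≤ _ := Finset.single_le_sum (f := fun β : Fin n →₀ ℕ => ∑ i, β i) (by simp) hβ

theorem mem_saturation_iff {f : MvPolynomial (Fin n) K} :
    f ∈ saturation I ↔ ∃ r, ∀ g ∈ idealOfVars (Fin n) K ^ r, f * g ∈ I := by
  rw [saturation, Submodule.mem_iSup_of_directed]
  · simp [Submodule.mem_colon]
  · refine Monotone.directed_le fun r s hrs => Submodule.colon_mono le_rfl ?_
    exact Ideal.pow_le_pow_right hrs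

/-- In degree above `n * M` some entry exceeds `M`. Multiplying by a power of that variable does not
change the truncation, hence does not affect membership in `I`. -/
theorem monomial_mem_of_mem_saturation {M : ℕ}
    (hM : ∀ α, monomial α (1 : K) ∈ I ↔ monomial (truncate M α) (1 : K) ∈ I) {α : Fin n →₀ ℕ}
    (hα : monomial α (1 : K) ∈ saturation I) (hdeg : n * M < α.degree) :
    monomial α (1 : K) ∈ I := by
  obtain ⟨i, hi⟩ : ∃ i, M < α i := by
    by_contra! h
    refine hdeg.not_ge ?_
    rw [Finsupp.degree_eq_sum]
    simpa using Finset.sum_le_sum fun i (_ : i ∈ Finset.univ) => h i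
  obtain ⟨r, hr⟩ := mem_saturation_iff.1 hα
  have h := hr (monomial (Finsupp.single i r) 1) (by
    rw [monomial_mem_pow_idealOfVars_iff _ _ one_ne_zero]; simp)
  rw [monomial_mul, one_mul, hM] at h
  have he : truncate M (α + Finsupp.single i r) = truncate M α := by
    ext j
    rcases eq_or_ne j i with rfl | hj
    · simp
      omega
    · simp [hj]
  rwa [hM, ← he]

theorem IsMonomialIdeal.agreeInLargeDegrees_iff (hI : IsMonomialIdeal I)
    (hJ : IsMonomialIdeal J) : AgreeInLargeDegrees I J ↔
      ∃ N, ∀ α : Fin n →₀ ℕ, N ≤ α.degree →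
        (monomial α (1 : K) ∈ I ↔ monomial α (1 : K) ∈ J) := by
  constructor
  · rintro ⟨N, h⟩
    exact ⟨N, fun α hα => h _ hα _ (isHomogeneous_monomial _ rfl)⟩
  · rintro ⟨N, h⟩
    refine ⟨N, fun k hk f hf => ?_⟩
    rw [hI.mem_iff, hJ.mem_iff]
    refine forall₂_congr fun α hα => h α ?_
    have hd : α.degree = k := by
      rw [Finsupp.degree_eq_weight_one]
      exact hf (mem_support_iff.1 hα)
    rwa [hd]

theorem saturation_le_of_agree (hI : IsMonomialIdeal I) (hJ : IsMonomialIdeal J) {N : ℕ}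
    (h : ∀ α : Fin n →₀ ℕ, N ≤ α.degree →
      (monomial α (1 : K) ∈ I → monomial α (1 : K) ∈ J)) :
    saturation I ≤ saturation J := by
  classical
  intro f hf
  obtain ⟨r, hr⟩ := mem_saturation_iff.1 hf
  -- The extra `N` puts every monomial of `f * g` in degree at least `N`, where the hypothesis
  -- applies.
  refine mem_saturation_iff.2 ⟨r + N, fun g hg => ?_⟩
  have h1 := hr g (Ideal.pow_le_pow_right (Nat.le_add_right r N) hg)
  rw [hI.mem_iff] at h1
  rw [hJ.mem_iff]
  intro α hα
  refine h α ?_ (h1 α hα)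
  obtain ⟨β, -, γ, hγ, rfl⟩ := Finset.mem_add.1 (support_mul f g hα)
  have := (mem_pow_idealOfVars_iff _ _).1 hg γ hγ
  rw [map_add]
  omega

theorem IsMonomialIdeal.saturation_eq_iff (hI : IsMonomialIdeal I) (hJ : IsMonomialIdeal J) :
    saturation I = saturation J ↔ AgreeInLargeDegrees I J := by
  rw [hI.agreeInLargeDegrees_iff hJ]
  constructor
  · intro h
    obtain ⟨M, hM⟩ := hI.exists_truncate
    obtain ⟨M', hM'⟩ := hJ.exists_truncate
    have hle : ∀ L : Ideal (MvPolynomial (Fin n) K), L ≤ saturation L := fun L f hf =>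
      mem_saturation_iff.2 ⟨0, fun g _ => L.mul_mem_right _ hf⟩
    refine ⟨n * M + n * M' + 1, fun α hα => ⟨fun hm => ?_, fun hm => ?_⟩⟩
    · exact monomial_mem_of_mem_saturation hM' (h ▸ hle I hm) (by omega)
    · exact monomial_mem_of_mem_saturation hM (h ▸ hle J hm) (by omega)
  · rintro ⟨N, h⟩
    exact le_antisymm (saturation_le_of_agree hI hJ fun α hα => (h α hα).1)
      (saturation_le_of_agree hJ hI fun α hα => (h α hα).2)

end MonomialIdeal

/-! ### Fibres of the toric parametrization -/

/-- The exponents of `x` and of `y` in the image of `t ^ α` under `t_i ↦ x ^ (d - i) * y ^ i`. -/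
def bidegree (d : ℕ) : (Fin (d + 1) →₀ ℕ) →+ ℕ × ℕ :=
  Finsupp.weight fun i : Fin (d + 1) => (d - (i : ℕ), (i : ℕ))

theorem bidegree_apply (d : ℕ) (α : Fin (d + 1) →₀ ℕ) :
    bidegree d α = (∑ i, α i * (d - (i : ℕ)), ∑ i, α i * (i : ℕ)) := by
  rw [bidegree, Finsupp.weight_apply, Finsupp.sum_fintype _ _ (by simp)]
  ext <;> simp [Prod.fst_sum, Prod.snd_sum]

/-- The two components of the bidegree add up to `d` times the degree. -/
theorem degree_eq_of_bidegree_eq {d : ℕ} (hd : 1 ≤ d) {α β : Fin (d + 1) →₀ ℕ}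
    (h : bidegree d α = bidegree d β) : α.degree = β.degree := by
  have key : ∀ γ : Fin (d + 1) →₀ ℕ, (bidegree d γ).1 + (bidegree d γ).2 = γ.degree * d := by
    intro γ
    rw [bidegree_apply, Finsupp.degree_eq_sum, Finset.sum_mul, ← Finset.sum_add_distrib]
    refine Finset.sum_congr rfl fun i _ => ?_
    rw [← mul_add]
    congr 1
    omega
  have h1 := key α
  rw [h, key β] at h1
  exact (Nat.eq_of_mul_eq_mul_right hd h1).symm

/-- The exponent `(a, b)` of a monomial in two variables. -/
def pairExponent (p : ℕ × ℕ) : Fin 2 →₀ ℕ := Finsupp.single 0 p.1 + Finsupp.single 1 p.2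

theorem pairExponent_injective : Function.Injective pairExponent := by
  intro p q h
  have h0 := DFunLike.congr_fun h 0
  have h1 := DFunLike.congr_fun h 1
  simp [pairExponent] at h0 h1
  exact Prod.ext h0 h1

theorem aeval_monomial_eq {K : Type*} [Field K] (d : ℕ) (α : Fin (d + 1) →₀ ℕ) (c : K) :
    aeval (fun i : Fin (d + 1) =>
      (X 0 ^ (d - (i : ℕ)) * X 1 ^ (i : ℕ) : MvPolynomial (Fin 2) K)) (monomial α c) =
      monomial (pairExponent (bidegree d α)) c := by
  rw [aeval_monomial, Finsupp.prod_fintype _ _ (by simp), bidegree_apply, pairExponent]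
  simp only [mul_pow, Finset.prod_mul_distrib, ← pow_mul, Finset.prod_pow_eq_pow_sum]
  simp only [mul_comm (α _), monomial_eq, algebraMap_eq]
  rw [Finsupp.prod_add_index' (by simp) (by simp [pow_add])]
  simp

theorem mem_rationalNormalCurveIdeal_iff {K : Type*} [Field K] {d : ℕ}
    {f : MvPolynomial (Fin (d + 1)) K} : f ∈ rationalNormalCurveIdeal K d ↔
      ∑ α ∈ f.support, monomial (pairExponent (bidegree d α)) (coeff α f) = 0 := by
  rw [rationalNormalCurveIdeal, RingHom.mem_ker]
  conv_lhs => rw [f.as_sum, map_sum]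
  simp only [aeval_monomial_eq]

/-- A smaller `β` in the fibre of `α` gives the binomial `t^α - t^β ∈ P` with leading exponent `α`.
Conversely, if `f ∈ P` has leading exponent `α` and `α` is least in its fibre, no other term of `f`
lies in that fibre, so nothing cancels the image of the leading term. -/
theorem monomial_notMem_initialIdeal_iff {K : Type*} [Field K] {d : ℕ}
    (τ : MonomialOrder.{0, 0} (Fin (d + 1))) (α : Fin (d + 1) →₀ ℕ) :
    monomial α (1 : K) ∉ initialIdeal τ (rationalNormalCurveIdeal K d) ↔
      ∀ β, bidegree d β = bidegree d α → τ.toSyn α ≤ τ.toSyn β := by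
  classical
  rw [monomial_mem_initialIdeal_iff]
  constructor
  · intro h β hβ
    by_contra! hlt
    have hne : α ≠ β := by rintro rfl; exact hlt.false
    refine h ⟨monomial α 1 - monomial β 1, ?_, ?_, ?_⟩
    · rw [rationalNormalCurveIdeal, RingHom.mem_ker, map_sub, aeval_monomial_eq,
        aeval_monomial_eq, hβ, sub_self]
    · rw [sub_ne_zero]
      intro he
      exact hne ((monomial_left_inj one_ne_zero).1 he)
    · rw [τ.degree_sub_of_lt] <;> simp [τ.degree_monomial, hlt]
  · rintro h ⟨f, hf, h0, rfl⟩
    rw [mem_rationalNormalCurveIdeal_iff] at hf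
    have hf' := congrArg (coeff (pairExponent (bidegree d (τ.degree f)))) hf
    rw [coeff_sum, coeff_zero, Finset.sum_eq_single_of_mem _ (τ.degree_mem_support h0)] at hf'
    · rw [coeff_monomial, if_pos rfl] at hf'
      exact mem_support_iff.1 (τ.degree_mem_support h0) hf'
    · intro β hβ hne
      rw [coeff_monomial, if_neg]
      intro he
      exact hne (τ.toSyn.injective (le_antisymm (τ.le_degree hβ)
        (h β (pairExponent_injective he))))

/-! ### The radical of an initial ideal -/

section RationalNormalCurve

variable {K : Type*} [Field K] {d : ℕ} {I J : Ideal (MvPolynomial (Fin (d + 1)) K)}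

theorem IsMonomialInitialIdeal.exists_order
    (hI : IsMonomialInitialIdeal (rationalNormalCurveIdeal K d) I) :
    ∃ τ : MonomialOrder.{0, 0} (Fin (d + 1)), ∀ α, monomial α (1 : K) ∉ I ↔
      ∀ β, bidegree d β = bidegree d α → τ.toSyn α ≤ τ.toSyn β := by
  obtain ⟨τ, rfl⟩ := hI
  exact ⟨τ, monomial_notMem_initialIdeal_iff τ⟩

theorem IsMonomialInitialIdeal.eq_of_bidegree_eq
    (hI : IsMonomialInitialIdeal (rationalNormalCurveIdeal K d) I) {α β : Fin (d + 1) →₀ ℕ}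
    (hα : monomial α (1 : K) ∉ I) (hβ : monomial β (1 : K) ∉ I)
    (h : bidegree d α = bidegree d β) : α = β := by
  obtain ⟨τ, hτ⟩ := hI.exists_order
  exact τ.toSyn.injective (le_antisymm ((hτ α).1 hα β h.symm) ((hτ β).1 hβ α h))

theorem IsMonomialInitialIdeal.exists_standard
    (hI : IsMonomialInitialIdeal (rationalNormalCurveIdeal K d) I) (α : Fin (d + 1) →₀ ℕ) :
    ∃ β, bidegree d β = bidegree d α ∧ monomial β (1 : K) ∉ I := by
  obtain ⟨τ, hτ⟩ := hI.exists_order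
  obtain ⟨β, hβ, hmin⟩ := (InvImage.wf τ.toSyn wellFounded_lt).has_min
    {β | bidegree d β = bidegree d α} ⟨α, rfl⟩
  refine ⟨β, hβ, (hτ β).2 fun γ hγ => ?_⟩
  exact not_lt.1 (hmin γ (hγ.trans hβ))

theorem X_mul_X_pow_eq {n : ℕ} (i j : Fin n) (k : ℕ) :
    (X i * X j : MvPolynomial (Fin n) K) ^ k =
      monomial (Finsupp.single i k + Finsupp.single j k) 1 := by
  rw [mul_pow, X_pow_eq_monomial, X_pow_eq_monomial, monomial_mul, one_mul]

theorem mem_radical_of_monomial_mem {n : ℕ} {I : Ideal (MvPolynomial (Fin n) K)} {i j : Fin n}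
    {α : Fin n →₀ ℕ} (hα : monomial α (1 : K) ∈ I) (hs : ∀ l, α l ≠ 0 → l = i ∨ l = j) :
    X i * X j ∈ I.radical := by
  refine ⟨α.degree, ?_⟩
  rw [X_mul_X_pow_eq]
  refine monomial_mem_of_le hα fun l => ?_
  by_cases hl : α l = 0
  · simp [hl]
  · have := Finsupp.le_degree l α
    rcases hs l hl with rfl | rfl <;> simp <;> omega

theorem X_mem_radical_of_sq {n : ℕ} {I : Ideal (MvPolynomial (Fin n) K)} {i : Fin n}
    (h : X i * X i ∈ I.radical) : X i ∈ I.radical := by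
  rw [← pow_two] at h
  exact I.radical_idem ▸ (⟨2, h⟩ : X i ∈ I.radical.radical)

/-- The monomials `t_c^(b-a)` and `t_a^(b-c) t_b^(c-a)` share a fibre, so at least one of them lies
in `I`; the first cannot, because `t_c ∉ √I`. -/
theorem IsMonomialInitialIdeal.X_mul_X_mem_radical
    (hI : IsMonomialInitialIdeal (rationalNormalCurveIdeal K d) I) {a b c : Fin (d + 1)}
    (hac : a < c) (hcb : c < b) (hc : X c ∉ I.radical) : X a * X b ∈ I.radical := by
  by_contra h
  have hac' : (a : ℕ) < c := hac
  have hcb' : (c : ℕ) < b := hcb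
  have h1 : monomial (Finsupp.single c ((b : ℕ) - a)) (1 : K) ∉ I := fun hm =>
    hc (X_mem_radical_of_sq (mem_radical_of_monomial_mem hm fun l hl => by
      by_contra! hne
      exact hl (by simp [hne.1])))
  have h2 : monomial (Finsupp.single a ((b : ℕ) - c) + Finsupp.single b ((c : ℕ) - a)) (1 : K)
      ∉ I := fun hm => h (mem_radical_of_monomial_mem hm fun l hl => by
      by_contra! hne
      exact hl (by simp [hne.1, hne.2]))
  have h3 := hI.eq_of_bidegree_eq h1 h2 (by
    have hb := b.is_lt
    simp only [bidegree, map_add, Finsupp.weight_single, Prod.smul_mk, smul_eq_mul, Prod.mk_add_mk]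
    obtain ⟨u, hu⟩ := Nat.exists_eq_add_of_lt hac'
    obtain ⟨v, hv⟩ := Nat.exists_eq_add_of_lt hcb'
    obtain ⟨w, hw⟩ := Nat.exists_eq_add_of_le (Nat.lt_succ_iff.1 hb)
    have e1 : (b : ℕ) - a = u + v + 2 := by omega
    have e2 : (b : ℕ) - c = v + 1 := by omega
    have e3 : (c : ℕ) - a = u + 1 := by omega
    have e4 : d - (c : ℕ) = v + 1 + w := by omega
    have e5 : d - (a : ℕ) = u + v + 2 + w := by omega
    have e6 : d - (b : ℕ) = w := by omega
    rw [e1, e2, e3, e4, e5, e6, hv, hu]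
    ext <;> simp only <;> ring)
  have h4 := DFunLike.congr_fun h3 c
  simp [hac.ne, hcb.ne'] at h4
  omega

/-- Each power of `t_0` is alone in its fibre: a zero exponent of `y` excludes all other variables,
and the degree fixes the power. It is therefore standard. -/
theorem IsMonomialInitialIdeal.X_zero_notMem_radical (hd : 1 ≤ d)
    (hI : IsMonomialInitialIdeal (rationalNormalCurveIdeal K d) I) : X 0 ∉ I.radical := by
  rintro ⟨N, hN⟩
  rw [X_pow_eq_monomial] at hN
  obtain ⟨β, hβ, hβI⟩ := hI.exists_standard (Finsupp.single 0 N)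
  have hdeg := degree_eq_of_bidegree_eq hd hβ
  have h2 := congrArg Prod.snd hβ
  rw [bidegree_apply, bidegree, Finsupp.weight_single] at h2
  simp at h2
  have hz : ∀ i, i ≠ 0 → β i = 0 := fun i hi => (h2 i).resolve_right hi
  have he : β = Finsupp.single 0 N := by
    ext i
    rcases eq_or_ne i 0 with rfl | hi
    · rw [Finsupp.degree_eq_sum, Finset.sum_eq_single 0 (fun i _ hi => hz i hi) (by simp)] at hdeg
      simpa using hdeg
    · simp [hz i hi, hi]
  exact hβI (he ▸ hN)

theorem IsMonomialInitialIdeal.X_last_notMem_radical (hd : 1 ≤ d)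
    (hI : IsMonomialInitialIdeal (rationalNormalCurveIdeal K d) I) :
    X (Fin.last d) ∉ I.radical := by
  rintro ⟨N, hN⟩
  rw [X_pow_eq_monomial] at hN
  obtain ⟨β, hβ, hβI⟩ := hI.exists_standard (Finsupp.single (Fin.last d) N)
  have hdeg := degree_eq_of_bidegree_eq hd hβ
  have h2 := congrArg Prod.fst hβ
  rw [bidegree_apply, bidegree, Finsupp.weight_single] at h2
  simp at h2
  have hz : ∀ i, i ≠ Fin.last d → β i = 0 := fun i hi => (h2 i).resolve_right fun h => hi <| by
    have := i.is_lt
    ext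
    simp
    omega
  have he : β = Finsupp.single (Fin.last d) N := by
    ext i
    rcases eq_or_ne i (Fin.last d) with rfl | hi
    · rw [Finsupp.degree_eq_sum, Finset.sum_eq_single (Fin.last d) (fun i _ hi => hz i hi)
        (by simp)] at hdeg
      simpa using hdeg
    · simp [hz i hi, hi]
  exact hβI (he ▸ hN)

/-- If `∑ i, β i * f i` is large, then `β i` is large at some index with `0 < f i`. -/
theorem exists_large_of_sum_eq {n : ℕ} (β : Fin n →₀ ℕ) (f : Fin n → ℤ) (D M : ℕ) {S : ℤ}
    (hf : ∀ i, f i ≤ D) (hS : n * (M * D) < S) (h : ∑ i, (β i : ℤ) * f i = S) :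
    ∃ i, M ≤ β i ∧ 0 < f i := by
  by_contra! hcon
  have : ∑ i, (β i : ℤ) * f i ≤ ∑ _i : Fin n, (M * D : ℤ) := by
    refine Finset.sum_le_sum fun i _ => ?_
    rcases le_or_gt M (β i) with h | h
    · have := mul_nonpos_of_nonneg_of_nonpos (Int.natCast_nonneg (β i)) (hcon i h)
      exact this.trans (by positivity)
    · have h' : (β i : ℤ) ≤ M := by exact_mod_cast h.le
      calc (β i : ℤ) * f i ≤ β i * D := mul_le_mul_of_nonneg_left (hf i) (by positivity)
        _ ≤ M * D := mul_le_mul_of_nonneg_right h' (by positivity)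
  rw [h] at this
  simp at this
  omega

/-- Take the standard `β` in the fibre of `t_a^N t_b^N` for large `N`. Its moments about `a` and `b`
force large entries at some `c > a` and some `e < b`. Large entries are at indices outside the
radical, so `e ≤ a < b ≤ c`, and `t_e t_c ∉ √I`. By betweenness `e = a` and `c = b`. -/
theorem IsMonomialInitialIdeal.X_mul_X_notMem_radical (hd : 1 ≤ d)
    (hI : IsMonomialInitialIdeal (rationalNormalCurveIdeal K d) I) {a b : Fin (d + 1)}
    (hab : a ≤ b) (ha : X a ∉ I.radical) (hb : X b ∉ I.radical)
    (hR : ∀ c, a < c → c < b → X c ∈ I.radical) : X a * X b ∉ I.radical := by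
  intro hmem
  rcases hab.eq_or_lt with rfl | hab
  · exact ha (X_mem_radical_of_sq hmem)
  obtain ⟨M, hM⟩ := I.exists_radical_pow_le_of_fg (IsNoetherian.noetherian _)
  -- The threshold is `2 * M`, not `M`, because for `i = j` the power `(t_i t_j)^M` is `t_i^(2M)`.
  -- `N` exceeds by one what `d + 1` entries below `2 * M` with weights at most `d` can contribute.
  set N := (d + 1) * ((2 * M) * d) + 1 with hN
  obtain ⟨β, hβ, hβI⟩ := hI.exists_standard (Finsupp.single a N + Finsupp.single b N)
  have hpair : ∀ i j, 2 * M ≤ β i → 2 * M ≤ β j → X i * X j ∉ I.radical := by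
    intro i j hi hj hij
    have h1 := hM (Ideal.pow_mem_pow hij M)
    rw [X_mul_X_pow_eq] at h1
    refine hβI (monomial_mem_of_le h1 fun l => ?_)
    simp only [Finsupp.add_apply, Finsupp.single_apply]
    split_ifs with h2 h3 h3
    · subst h2
      omega
    · subst h2
      omega
    · subst h3
      omega
    · omega
  have hdeg := degree_eq_of_bidegree_eq hd hβ
  rw [Finsupp.degree_eq_sum] at hdeg
  have hdeg' : ∑ i, (β i : ℤ) = 2 * N := by
    rw [← Nat.cast_sum, hdeg]
    simp
    ring
  have hsnd := congrArg Prod.snd hβ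
  rw [bidegree_apply, bidegree, map_add, Finsupp.weight_single, Finsupp.weight_single] at hsnd
  have hsnd' : ∑ i, (β i : ℤ) * (i : ℕ) = N * (a : ℕ) + N * (b : ℕ) := by
    have := congrArg (Nat.cast : ℕ → ℤ) hsnd
    simpa using this
  have hlt : (a : ℕ) < b := hab
  have hNpos : (N : ℤ) ≤ N * ((b : ℕ) - (a : ℕ) : ℤ) := by
    refine le_mul_of_one_le_right (by positivity) ?_
    omega
  obtain ⟨c, hcM, hac⟩ := exists_large_of_sum_eq β (fun i => ((i : ℕ) : ℤ) - (a : ℕ)) d (2 * M)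
    (S := N * ((b : ℕ) - (a : ℕ) : ℤ)) (fun i => by have := i.is_lt; omega)
    (lt_of_lt_of_le (by rw [hN]; push_cast; omega) hNpos) (by
      simp only [mul_sub, Finset.sum_sub_distrib, ← Finset.sum_mul, hdeg', hsnd']
      ring)
  obtain ⟨e, heM, heb⟩ := exists_large_of_sum_eq β (fun i => ((b : ℕ) : ℤ) - (i : ℕ)) d (2 * M)
    (S := N * ((b : ℕ) - (a : ℕ) : ℤ)) (fun i => by have := b.is_lt; omega)
    (lt_of_lt_of_le (by rw [hN]; push_cast; omega) hNpos) (by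
      simp only [mul_sub, Finset.sum_sub_distrib, ← Finset.sum_mul, hdeg', hsnd']
      ring)
  have hac : a < c := by rw [Fin.lt_def]; omega
  have heb : e < b := by rw [Fin.lt_def]; omega
  have hcR : X c ∉ I.radical := fun h => hpair c c hcM hcM (Ideal.mul_mem_left _ _ h)
  have heR : X e ∉ I.radical := fun h => hpair e e heM heM (Ideal.mul_mem_left _ _ h)
  have hbc : b ≤ c := not_lt.1 fun h => hcR (hR c hac h)
  have hea : e ≤ a := not_lt.1 fun h => heR (hR e h heb)
  rcases hea.eq_or_lt with rfl | hea
  · rcases hbc.eq_or_lt with rfl | hbc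
    · exact hpair _ _ heM hcM hmem
    · exact hpair _ _ heM hcM (hI.X_mul_X_mem_radical heb hbc hb)
  · exact hpair _ _ heM hcM (hI.X_mul_X_mem_radical hea hac ha)

/-- Let `t^α ∈ I` involve no variable of `√J`, and let `a`, `b` be the ends of its support. If some
`t_c ∉ √J` lies strictly between, then `t_a t_b ∈ √J`. Otherwise the support is within `{a, b}`,
giving `t_a t_b ∈ √I` for consecutive indices, which is impossible. -/
theorem IsMonomialInitialIdeal.radical_le (hd : 1 ≤ d)
    (hI : IsMonomialInitialIdeal (rationalNormalCurveIdeal K d) I)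
    (hJ : IsMonomialInitialIdeal (rationalNormalCurveIdeal K d) J)
    (h : ∀ i, X i ∈ I.radical ↔ X i ∈ J.radical) : I.radical ≤ J.radical := by
  rw [Ideal.radical_le_radical_iff]
  obtain ⟨s, hs⟩ := hI.isMonomialIdeal
  have key : ∀ α, monomial α (1 : K) ∈ I → monomial α (1 : K) ∈ J.radical := by
    intro α hα
    have hfac : ∀ β, β ≤ α → monomial β (1 : K) ∈ J.radical → monomial α (1 : K) ∈ J.radical :=
      fun β hle hβ => monomial_mem_of_le hβ hle
    by_cases h1 : ∃ c, α c ≠ 0 ∧ X c ∈ J.radical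
    · obtain ⟨c, hc, hcJ⟩ := h1
      refine hfac (Finsupp.single c 1) ?_ hcJ
      rw [Finsupp.single_le_iff]
      omega
    push Not at h1
    have h0 : α.support.Nonempty := by
      rw [Finset.nonempty_iff_ne_empty, Ne, Finsupp.support_eq_empty]
      rintro rfl
      exact hI.X_zero_notMem_radical hd (X_mem_radical_of_sq
        (mem_radical_of_monomial_mem hα (by simp)))
    set a := α.support.min' h0
    set b := α.support.max' h0
    have ha : α a ≠ 0 := Finsupp.mem_support_iff.1 (α.support.min'_mem h0)
    have hb : α b ≠ 0 := Finsupp.mem_support_iff.1 (α.support.max'_mem h0)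
    by_cases h2 : ∃ c, a < c ∧ c < b ∧ X c ∉ J.radical
    · obtain ⟨c, hac, hcb, hc⟩ := h2
      have h3 := hJ.X_mul_X_mem_radical hac hcb hc
      have h4 := X_mul_X_pow_eq (K := K) a b 1
      rw [pow_one] at h4
      rw [h4] at h3
      refine hfac _ (fun l => ?_) h3
      have hne : a ≠ b := (hac.trans hcb).ne
      simp only [Finsupp.add_apply, Finsupp.single_apply]
      split_ifs with h5 h6 h6
      · exact absurd (h5.trans h6.symm) hne
      · subst h5
        omega
      · subst h6
        omega
      · omega
    · push Not at h2
      refine absurd (mem_radical_of_monomial_mem (i := a) (j := b) hα fun l hl => ?_)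
        (hI.X_mul_X_notMem_radical hd (Finset.min'_le_max' _ h0) (fun h' => h1 a ha ((h a).1 h'))
          (fun h' => h1 b hb ((h b).1 h')) fun c hac hcb => (h c).2 (h2 c hac hcb))
      by_contra! hne
      have hl' : l ∈ α.support := Finsupp.mem_support_iff.2 hl
      exact h1 l hl (h2 l (lt_of_le_of_ne (Finset.min'_le _ _ hl') hne.1.symm)
        (lt_of_le_of_ne (Finset.le_max' _ _ hl') hne.2))
  rw [hs, Ideal.span_le]
  rintro _ ⟨α, hα, rfl⟩
  exact key α (hs ▸ Ideal.subset_span ⟨α, hα, rfl⟩)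

/-! ### The linear form `e_0` -/

theorem coeff_single_sum_C_mul_X {R : Type*} [CommSemiring R] {n : ℕ} (s : Finset (Fin n))
    (c : Fin n → R) (j : Fin n) :
    coeff (Finsupp.single j 1) (∑ i ∈ s, C (c i) * X i) = if j ∈ s then c j else 0 := by
  classical
  rw [coeff_sum]
  simp [coeff_C_mul, coeff_X, Finsupp.single_left_inj]

theorem predIn_le {n : ℕ} (s : Finset (Fin n)) (j : Fin n) : predIn s j ≤ j := by
  rw [predIn]
  split_ifs with h
  · exact (Finset.mem_filter.1 (Finset.max'_mem _ h)).2.le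
  · exact le_rfl

theorem le_succIn {n : ℕ} (s : Finset (Fin n)) (j : Fin n) : j ≤ succIn s j := by
  rw [succIn]
  split_ifs with h
  · exact (Finset.mem_filter.1 (Finset.min'_mem _ h)).2.le
  · exact le_rfl

theorem predIn_lt {n : ℕ} {s : Finset (Fin n)} {i j : Fin n} (hi : i ∈ s) (hij : i < j) :
    predIn s j < j := by
  have h : (s.filter fun l => l < j).Nonempty := ⟨i, Finset.mem_filter.2 ⟨hi, hij⟩⟩
  rw [predIn, dif_pos h]
  exact (Finset.mem_filter.1 (Finset.max'_mem _ h)).2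

theorem lt_succIn {n : ℕ} {s : Finset (Fin n)} {i j : Fin n} (hi : i ∈ s) (hij : j < i) :
    j < succIn s j := by
  have h : (s.filter fun l => j < l).Nonempty := ⟨i, Finset.mem_filter.2 ⟨hi, hij⟩⟩
  rw [succIn, dif_pos h]
  exact (Finset.mem_filter.1 (Finset.min'_mem _ h)).2

theorem mem_radicalIndices {n : ℕ} {I : Ideal (MvPolynomial (Fin n) K)} {j : Fin n} :
    j ∈ radicalIndices I ↔ X j ∉ I.radical := by
  classical
  simp [radicalIndices]

/-- The indices `0` and `d` are both in the set and are distinct, so every member has a neighbour on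
at least one side and its coefficient is positive. -/
theorem IsMonomialInitialIdeal.mem_radicalIndices_iff_coeff_e0 (hd : 1 ≤ d)
    (hI : IsMonomialInitialIdeal (rationalNormalCurveIdeal K d) I) (j : Fin (d + 1)) :
    j ∈ radicalIndices I ↔ coeff (Finsupp.single j 1) (e0 I) ≠ 0 := by
  rw [e0, coeff_single_sum_C_mul_X]
  split_ifs with h
  · simp only [h, true_iff]
    have h1 := predIn_le (radicalIndices I) j
    have h2 := le_succIn (radicalIndices I) j
    rw [Fin.le_def] at h1 h2
    rcases Nat.eq_zero_or_pos (j : ℕ) with h0 | h0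
    · have h3 := lt_succIn (mem_radicalIndices.2 (hI.X_last_notMem_radical hd)) (j := j) (by
        rw [Fin.lt_def, Fin.val_last]
        omega)
      rw [Fin.lt_def] at h3
      omega
    · have h3 := predIn_lt (mem_radicalIndices.2 (hI.X_zero_notMem_radical hd)) (j := j) (by
        rw [Fin.lt_def]
        simpa using h0)
      rw [Fin.lt_def] at h3
      omega
  · simp [h]

theorem IsMonomialInitialIdeal.e0_eq_iff (hd : 1 ≤ d)
    (hI : IsMonomialInitialIdeal (rationalNormalCurveIdeal K d) I)
    (hJ : IsMonomialInitialIdeal (rationalNormalCurveIdeal K d) J) :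
    e0 I = e0 J ↔ I.radical = J.radical := by
  constructor
  · intro h
    have key : ∀ i, X i ∈ I.radical ↔ X i ∈ J.radical := fun i => by
      rw [← not_iff_not, ← mem_radicalIndices, ← mem_radicalIndices,
        hI.mem_radicalIndices_iff_coeff_e0 hd, hJ.mem_radicalIndices_iff_coeff_e0 hd, h]
    exact le_antisymm (hI.radical_le hd hJ key) (hJ.radical_le hd hI fun i => (key i).symm)
  · intro h
    have hR : radicalIndices I = radicalIndices J := by
      ext i
      rw [mem_radicalIndices, mem_radicalIndices, h]
    rw [e0, e0, hR]

end RationalNormalCurve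

/-! ### Coefficients of `H^I` as sums of standard exponents -/

section StandardMonomials

variable {K : Type*} [Field K] {n : ℕ}

open Classical in
/-- The exponents of degree `k` of the monomials outside `I`. -/
def standardExponents (I : Ideal (MvPolynomial (Fin n) K)) (k : ℕ) : Finset (Fin n →₀ ℕ) :=
  {α ∈ Finset.univ.finsuppAntidiag k | monomial α (1 : K) ∉ I}

theorem mem_finsuppAntidiag_univ {k : ℕ} {α : Fin n →₀ ℕ} :
    α ∈ Finset.univ.finsuppAntidiag k ↔ α.degree = k := by
  simp [Finsupp.degree_eq_sum]

theorem mem_standardExponents {I : Ideal (MvPolynomial (Fin n) K)} {k : ℕ} {α : Fin n →₀ ℕ} :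
    α ∈ standardExponents I k ↔ α.degree = k ∧ monomial α (1 : K) ∉ I := by
  classical
  rw [standardExponents, Finset.mem_filter, mem_finsuppAntidiag_univ]

/-- The `i`-th entry of the sum of all exponents of degree `k` of the monomials outside `I`. -/
def standardSum (I : Ideal (MvPolynomial (Fin n) K)) (k : ℕ) (i : Fin n) : ℤ :=
  ∑ α ∈ standardExponents I k, (α i : ℤ)

/-- The derivative of `t^α` carries the factor `α i` and lowers the degree by one, hence `k + 1`.
Exponents with `α i = 0` are missed by the shift but contribute zero. -/
theorem coeff_diagonal_pderiv (I : Ideal (MvPolynomial (Fin n) K)) (k : ℕ) (i : Fin n) :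
    PowerSeries.coeff k (diagonal (MvPowerSeries.pderiv ℤ i (multigradedHilbertSeries I))) =
      standardSum I (k + 1) i := by
  classical
  rw [diagonal, PowerSeries.coeff_mk, standardSum, standardExponents, Finset.sum_filter]
  simp only [MvPowerSeries.coeff_pderiv]
  symm
  have hinj : Set.InjOn (fun α : Fin n →₀ ℕ => α + Finsupp.single i 1)
      (Finset.univ.finsuppAntidiag k : Finset (Fin n →₀ ℕ)) := fun α _ β _ h => add_right_cancel h
  rw [← Finset.sum_subset (s₁ := (Finset.univ.finsuppAntidiag k).image
    fun α : Fin n →₀ ℕ => α + Finsupp.single i 1), Finset.sum_image hinj]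
  · refine Finset.sum_congr rfl fun α _ => ?_
    change _ = (if _ then _ else _) * _
    split_ifs <;> simp_all
  · intro α hα
    obtain ⟨β, hβ, rfl⟩ := Finset.mem_image.1 hα
    rw [mem_finsuppAntidiag_univ] at hβ ⊢
    simp [hβ]
  · intro α hα hα'
    rw [mem_finsuppAntidiag_univ] at hα
    by_cases h0 : α i = 0
    · simp [h0]
    · have hle : Finsupp.single i 1 ≤ α := by
        rw [Finsupp.single_le_iff]
        omega
      obtain ⟨β, rfl⟩ := exists_add_of_le hle
      rw [map_add, Finsupp.degree_single] at hα
      have hβ : β ∈ Finset.univ.finsuppAntidiag k := by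
        rw [mem_finsuppAntidiag_univ]
        omega
      rw [add_comm] at hα'
      exact absurd (Finset.mem_image_of_mem (fun α => α + Finsupp.single i 1) hβ) hα'

theorem coeff_hilbertOneSeries (I : Ideal (MvPolynomial (Fin n) K)) (k : ℕ) :
    PowerSeries.coeff k (hilbertOneSeries I) =
      ∑ i : Fin n, C (standardSum I (k + 1) i) * X i := by
  rw [hilbertOneSeries, map_sum]
  refine Finset.sum_congr rfl fun i _ => ?_
  rw [PowerSeries.coeff_C_mul, PowerSeries.coeff_map, coeff_diagonal_pderiv, mul_comm]

theorem standardSum_eq_of_coeff_eq {I J : Ideal (MvPolynomial (Fin n) K)} {k : ℕ}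
    (h : PowerSeries.coeff k (hilbertOneSeries I) = PowerSeries.coeff k (hilbertOneSeries J)) :
    standardSum I (k + 1) = standardSum J (k + 1) := by
  ext i
  have h1 := congrArg (coeff (Finsupp.single i 1)) h
  rw [coeff_hilbertOneSeries, coeff_hilbertOneSeries, coeff_single_sum_C_mul_X,
    coeff_single_sum_C_mul_X] at h1
  simpa using h1

theorem hilbertOneSeries_coeff_eq_of_agree {I J : Ideal (MvPolynomial (Fin n) K)} {k : ℕ}
    (h : ∀ α : Fin n →₀ ℕ, α.degree = k + 1 →
      (monomial α (1 : K) ∈ I ↔ monomial α (1 : K) ∈ J)) :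
    PowerSeries.coeff k (hilbertOneSeries I) = PowerSeries.coeff k (hilbertOneSeries J) := by
  have hs : standardExponents I (k + 1) = standardExponents J (k + 1) := by
    ext α
    rw [mem_standardExponents, mem_standardExponents]
    exact and_congr_right fun hα => not_congr (h α hα)
  simp only [coeff_hilbertOneSeries, standardSum, hs]

end StandardMonomials

/-! ### The series determines the ideal -/

section Determination

variable {K : Type*} [Field K] {d : ℕ} {I J : Ideal (MvPolynomial (Fin (d + 1)) K)}

/-- In each degree, the standard monomials of `I` are minimal in their fibres, so their sum is
minimal as well, and it determines them. -/
theorem IsMonomialInitialIdeal.standardExponents_eq (hd : 1 ≤ d)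
    (hI : IsMonomialInitialIdeal (rationalNormalCurveIdeal K d) I)
    (hJ : IsMonomialInitialIdeal (rationalNormalCurveIdeal K d) J) {k : ℕ}
    (h : standardSum I k = standardSum J k) : standardExponents I k = standardExponents J k := by
  classical
  obtain ⟨τ, hτ⟩ := hI.exists_order
  -- `g` sends an exponent to the `J`-standard one of its fibre; in degree `k` it is a bijection
  -- from the standard exponents of `I` to those of `J`.
  choose g hg hgJ using hJ.exists_standard
  have hmem : ∀ α ∈ standardExponents I k, g α ∈ standardExponents J k := fun α hα =>
    mem_standardExponents.2 ⟨(degree_eq_of_bidegree_eq hd (hg α)).trans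
      (mem_standardExponents.1 hα).1, hgJ α⟩
  have hinj : Set.InjOn g (standardExponents I k) := fun α hα β hβ hαβ =>
    hI.eq_of_bidegree_eq (mem_standardExponents.1 hα).2 (mem_standardExponents.1 hβ).2
      ((hg α).symm.trans (hαβ ▸ hg β))
  have himage : (standardExponents I k).image g = standardExponents J k := by
    refine Finset.Subset.antisymm (Finset.image_subset_iff.2 hmem) fun β hβ => ?_
    obtain ⟨hβk, hβJ⟩ := mem_standardExponents.1 hβ
    obtain ⟨α, hα, hαI⟩ := hI.exists_standard β
    exact Finset.mem_image.2 ⟨α, mem_standardExponents.2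
      ⟨(degree_eq_of_bidegree_eq hd hα).trans hβk, hαI⟩,
      hJ.eq_of_bidegree_eq (hgJ α) hβJ ((hg α).trans hα)⟩
  have hsum : ∑ α ∈ standardExponents I k, α = ∑ α ∈ standardExponents I k, g α := by
    rw [← Finset.sum_image (f := fun α => α) hinj, himage]
    ext i
    have := congrFun h i
    simp only [standardSum] at this
    rw [Finsupp.finsetSum_apply, Finsupp.finsetSum_apply]
    exact_mod_cast this
  have hle : ∀ α ∈ standardExponents I k, τ.toSyn α ≤ τ.toSyn (g α) := fun α hα =>
    (hτ α).1 (mem_standardExponents.1 hα).2 _ (hg α)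
  -- `τ.toSyn` is additive, so equal vector sums give equal sums in the ordered monoid, and termwise
  -- `≤` becomes equality.
  have heq := (Finset.sum_eq_sum_iff_of_le hle).1 (by rw [← map_sum, ← map_sum, hsum])
  rw [← himage]
  ext α
  constructor
  · intro hα
    exact Finset.mem_image.2 ⟨α, hα, (τ.toSyn.injective (heq α hα)).symm⟩
  · intro hα
    obtain ⟨β, hβ, rfl⟩ := Finset.mem_image.1 hα
    rwa [← τ.toSyn.injective (heq β hβ)]

theorem mem_iff_of_standardExponents_eq {n : ℕ} {I J : Ideal (MvPolynomial (Fin n) K)} {k : ℕ}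
    (h : standardExponents I k = standardExponents J k) {α : Fin n →₀ ℕ} (hα : α.degree = k) :
    monomial α (1 : K) ∈ I ↔ monomial α (1 : K) ∈ J := by
  have h1 : α ∈ standardExponents I k ↔ α ∈ standardExponents J k := by rw [h]
  simpa [mem_standardExponents, hα, not_iff_not] using h1

theorem standardSum_zero {n : ℕ} (I : Ideal (MvPolynomial (Fin n) K)) : standardSum I 0 = 0 := by
  ext i
  refine Finset.sum_eq_zero fun α hα => ?_
  have h := (mem_standardExponents.1 hα).1
  rw [Finsupp.degree_eq_zero_iff] at h
  simp [h]

theorem IsMonomialInitialIdeal.eq_of_hilbertOneSeries_eq (hd : 1 ≤ d)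
    (hI : IsMonomialInitialIdeal (rationalNormalCurveIdeal K d) I)
    (hJ : IsMonomialInitialIdeal (rationalNormalCurveIdeal K d) J)
    (h : hilbertOneSeries I = hilbertOneSeries J) : I = J := by
  refine hI.isMonomialIdeal.ext hJ.isMonomialIdeal fun α => ?_
  refine mem_iff_of_standardExponents_eq (hI.standardExponents_eq hd hJ ?_) rfl
  -- Differentiation discards degree zero, but there the sum of exponents is zero for any ideal.
  rcases α.degree with _ | k
  · rw [standardSum_zero, standardSum_zero]
  · exact standardSum_eq_of_coeff_eq (by rw [h])

theorem IsMonomialInitialIdeal.agreeInLargeDegrees_iff_coeff (hd : 1 ≤ d)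
    (hI : IsMonomialInitialIdeal (rationalNormalCurveIdeal K d) I)
    (hJ : IsMonomialInitialIdeal (rationalNormalCurveIdeal K d) J) :
    AgreeInLargeDegrees I J ↔ ∃ N, ∀ k, N ≤ k →
      PowerSeries.coeff k (hilbertOneSeries I) = PowerSeries.coeff k (hilbertOneSeries J) := by
  rw [hI.isMonomialIdeal.agreeInLargeDegrees_iff hJ.isMonomialIdeal]
  constructor
  · rintro ⟨N, h⟩
    exact ⟨N, fun k hk => hilbertOneSeries_coeff_eq_of_agree fun α hα => h α (by omega)⟩
  · rintro ⟨N, h⟩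
    refine ⟨N + 1, fun α hα => ?_⟩
    refine mem_iff_of_standardExponents_eq (hI.standardExponents_eq hd hJ ?_) rfl
    obtain ⟨k, hk⟩ := Nat.exists_eq_add_of_le' (le_of_add_le_right hα)
    rw [hk]
    exact standardSum_eq_of_coeff_eq (h k (by omega))

theorem IsHPolynomial.eq_iff {n : ℕ} {I J : Ideal (MvPolynomial (Fin n) K)}
    {p q : Polynomial (MvPolynomial (Fin n) ℤ)} (hp : IsHPolynomial I p)
    (hq : IsHPolynomial J q) : p = q ↔ hilbertOneSeries I = hilbertOneSeries J := by
  rw [← Polynomial.coe_inj, hp, hq]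
  refine mul_right_inj' (pow_ne_zero 3 fun h => ?_)
  have h1 := congrArg (PowerSeries.coeff 0) h
  simp at h1

/-- Polynomials over a domain that agree at infinitely many integers are equal, and passing from
`ℤ[A]` to `ℚ[A]` loses nothing. -/
theorem IsHilbertPolynomialOne.eq_iff {n : ℕ} {I J : Ideal (MvPolynomial (Fin n) K)}
    {P Q : Polynomial (MvPolynomial (Fin n) ℚ)} (hP : IsHilbertPolynomialOne I P)
    (hQ : IsHilbertPolynomialOne J Q) : P = Q ↔ ∃ N, ∀ k, N ≤ k →
      PowerSeries.coeff k (hilbertOneSeries I) = PowerSeries.coeff k (hilbertOneSeries J) := by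
  obtain ⟨N₁, h₁⟩ := hP
  obtain ⟨N₂, h₂⟩ := hQ
  have hinj : Function.Injective (MvPolynomial.map (σ := Fin n) (Int.castRingHom ℚ)) :=
    map_injective _ Int.cast_injective
  constructor
  · rintro rfl
    refine ⟨N₁ + N₂, fun k hk => hinj ?_⟩
    rw [← h₁ k (by omega), ← h₂ k (by omega)]
  · rintro ⟨N, h⟩
    refine Polynomial.eq_of_infinite_eval_eq P Q ?_
    refine Set.Infinite.mono (s := Nat.cast '' Set.Ici (N + N₁ + N₂)) ?_
      ((Set.Ici_infinite _).image Nat.cast_injective.injOn)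
    rintro _ ⟨k, hk, rfl⟩
    have hk' : N + N₁ + N₂ ≤ k := hk
    change Polynomial.eval _ P = Polynomial.eval _ Q
    rw [h₁ k (by omega), h₂ k (by omega), h k (by omega)]

end Determination

/-! ### Quadratic growth over a fixed truncation -/

section Quadratic

/-- `f` is eventually given by a polynomial of degree at most two. -/
def EventuallyQuadratic (f : ℕ → ℤ) : Prop :=
  ∃ (a b c : ℤ) (N : ℕ), ∀ k, N ≤ k → 2 * f k = a + b * k + c * k ^ 2

theorem EventuallyQuadratic.sum {ι : Type*} (s : Finset ι) {f : ι → ℕ → ℤ}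
    (h : ∀ i ∈ s, EventuallyQuadratic (f i)) : EventuallyQuadratic fun k => ∑ i ∈ s, f i k := by
  classical
  induction s using Finset.induction_on with
  | empty => exact ⟨0, 0, 0, 0, by simp⟩
  | insert i s hi ih =>
    obtain ⟨a, b, c, N, h₁⟩ := ih fun j hj => h j (Finset.mem_insert_of_mem hj)
    obtain ⟨a', b', c', N', h₂⟩ := h i (Finset.mem_insert_self i s)
    refine ⟨a + a', b + b', c + c', N + N', fun k hk => ?_⟩
    beta_reduce at h₁ ⊢
    rw [Finset.sum_insert hi, mul_add, h₁ k (by omega), h₂ k (by omega)]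
    ring

theorem EventuallyQuadratic.exists_third_difference {f : ℕ → ℤ} (h : EventuallyQuadratic f) :
    ∃ N, ∀ k, N ≤ k → f (k + 3) - 3 * f (k + 2) + 3 * f (k + 1) - f k = 0 := by
  obtain ⟨a, b, c, N, h⟩ := h
  refine ⟨N, fun k hk => ?_⟩
  have h0 := h k hk
  have h1 := h (k + 1) (by omega)
  have h2 := h (k + 2) (by omega)
  have h3 := h (k + 3) (by omega)
  push_cast at h1 h2 h3
  have : 2 * (f (k + 3) - 3 * f (k + 2) + 3 * f (k + 1) - f k) = 0 := by
    linear_combination h3 - 3 * h2 + 3 * h1 - h0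
  omega

variable {n : ℕ}

open Classical in
/-- The exponents of degree `k` with a given truncation. -/
def truncateFiber (M : ℕ) (β : Fin n →₀ ℕ) (k : ℕ) : Finset (Fin n →₀ ℕ) :=
  (Finset.univ.finsuppAntidiag k).filter fun α => truncate M α = β

theorem mem_truncateFiber {M k : ℕ} {α β : Fin n →₀ ℕ} :
    α ∈ truncateFiber M β k ↔ α.degree = k ∧ truncate M α = β := by
  rw [truncateFiber, Finset.mem_filter, mem_finsuppAntidiag_univ]

theorem truncate_eq_iff {M : ℕ} {α β : Fin n →₀ ℕ} (hβ : ∀ i, β i ≤ M) :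
    truncate M α = β ↔ ∀ i, β i ≤ α i ∧ (β i ≠ M → α i = β i) := by
  rw [DFunLike.ext_iff]
  refine forall_congr' fun i => ?_
  have := hβ i
  rw [truncate_apply]
  omega

/-- Only entries equal to the cap `M` can grow. With `m = k - β.degree` units to distribute over `c`
and `e`, the fibre is one point if `c = e`, and otherwise `m + 1` points along a segment, whose
coordinates add up to a quadratic in `m`. -/
theorem eventuallyQuadratic_truncateFiber {M : ℕ} {β : Fin n →₀ ℕ} (hβ : ∀ i, β i ≤ M)
    {c e : Fin n} (hce : ∀ i, β i = M → i = c ∨ i = e) (hcM : β c = M) (heM : β e = M)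
    (i : Fin n) :
    EventuallyQuadratic fun k => ∑ α ∈ truncateFiber M β k, (α i : ℤ) := by
  classical
  rcases eq_or_ne c e with rfl | hne
  · have hc : ∀ j, β j = M → j = c := fun j hj => (hce j hj).elim id id
    set u : ℤ := if c = i then 1 else 0 with hu
    refine ⟨2 * (β i - u * β.degree), 2 * u, 0, β.degree, fun k hk => ?_⟩
    have hfib : truncateFiber M β k = {β + Finsupp.single c (k - β.degree)} := by
      ext α
      rw [mem_truncateFiber, Finset.mem_singleton, truncate_eq_iff hβ]
      constructor
      · rintro ⟨hα, h⟩
        obtain ⟨γ, rfl⟩ := exists_add_of_le (show β ≤ α from fun j => (h j).1)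
        have hγ : γ = Finsupp.single c (γ c) := by
          ext j
          rcases eq_or_ne j c with rfl | hj
          · simp
          · have := (h j).2 fun h' => hj (hc j h')
            simp at this
            simp [hj, this]
        rw [hγ, map_add, Finsupp.degree_single] at hα
        rw [hγ, ← hα]
        simp
      · rintro rfl
        refine ⟨by rw [map_add, Finsupp.degree_single]; omega, fun j => ⟨by simp, fun hj => ?_⟩⟩
        have : j ≠ c := by rintro rfl; exact hj hcM
        simp [this]
    simp only [hfib, Finset.sum_singleton, Finsupp.add_apply, Finsupp.single_apply]
    obtain ⟨m, rfl⟩ := Nat.exists_eq_add_of_le hk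
    split_ifs at hu ⊢ <;> simp [hu] <;> ring
  · set u : ℤ := if c = i then 1 else 0 with hu
    set v : ℤ := if e = i then 1 else 0 with hv
    set s : ℤ := (β.degree : ℤ) with hs
    -- These are the coefficients of `2 (m + 1) β i + (u + v) m (m + 1)` expanded in `k = s + m`.
    refine ⟨2 * (1 - s) * β i + (u + v) * (s ^ 2 - s), 2 * β i + (u + v) * (1 - 2 * s), u + v,
      β.degree, fun k hk => ?_⟩
    obtain ⟨m, rfl⟩ := Nat.exists_eq_add_of_le hk
    have hfib : truncateFiber M β (β.degree + m) = (Finset.range (m + 1)).image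
        fun l => β + (Finsupp.single c l + Finsupp.single e (m - l)) := by
      ext α
      rw [mem_truncateFiber, Finset.mem_image, truncate_eq_iff hβ]
      constructor
      · rintro ⟨hα, h⟩
        obtain ⟨γ, rfl⟩ := exists_add_of_le (show β ≤ α from fun j => (h j).1)
        have hγ : γ = Finsupp.single c (γ c) + Finsupp.single e (γ e) := by
          ext j
          by_cases hj : j = c ∨ j = e
          · rcases hj with rfl | rfl
            · simp [hne]
            · simp [hne.symm]
          · have := (h j).2 fun h' => hj (hce j h')
            push Not at hj
            simp at this
            simp [hj, this]
        have hdeg := congrArg Finsupp.degree hγ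
        rw [map_add, Finsupp.degree_single, Finsupp.degree_single] at hdeg
        rw [map_add] at hα
        have hle : γ c + γ e = m := by omega
        refine ⟨γ c, Finset.mem_range.2 (by omega), ?_⟩
        rw [← hle, Nat.add_sub_cancel_left, ← hγ]
      · rintro ⟨l, hl, rfl⟩
        rw [Finset.mem_range] at hl
        refine ⟨by simp only [map_add, Finsupp.degree_single]; omega, fun j => ⟨by simp, fun hj => ?_⟩⟩
        have h1 : j ≠ c := by rintro rfl; exact hj hcM
        have h2 : j ≠ e := by rintro rfl; exact hj heM
        simp [h1, h2]
    have hinj : Set.InjOn (fun l => β + (Finsupp.single c l + Finsupp.single e (m - l)))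
        (Finset.range (m + 1)) := by
      intro l _ l' _ h
      have := DFunLike.congr_fun h c
      simpa [hne] using this
    beta_reduce
    rw [hfib, Finset.sum_image hinj]
    have hterm : ∀ l ∈ Finset.range (m + 1),
        (((β + (Finsupp.single c l + Finsupp.single e (m - l)) : Fin n →₀ ℕ) i : ℕ) : ℤ) =
          (β i + v * m) + (u - v) * l := by
      intro l hl
      rw [Finset.mem_range] at hl
      have : ((m - l : ℕ) : ℤ) = m - l := by omega
      simp only [Finsupp.add_apply, Finsupp.single_apply]
      push_cast
      rw [hu, hv]
      split_ifs <;> simp [this] <;> ring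
    rw [Finset.sum_congr rfl hterm, Finset.sum_add_distrib, ← Finset.mul_sum]
    have hgauss : (∑ l ∈ Finset.range (m + 1), (l : ℤ)) * 2 = (m + 1) * m := by
      have := Finset.sum_range_id_mul_two (m + 1)
      rw [Nat.add_sub_cancel] at this
      have h' := congrArg (Nat.cast : ℕ → ℤ) this
      push_cast at h'
      exact h'
    simp only [Finset.sum_const, Finset.card_range, nsmul_eq_mul]
    push_cast
    linear_combination (u - v) * hgauss

/-- With no entry at the cap, `β` is the only exponent with this truncation, so the fibre is empty
in degrees above that of `β`. -/
theorem eventuallyQuadratic_truncateFiber_of_lt {M : ℕ} {β : Fin n →₀ ℕ} (hβ : ∀ i, β i < M)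
    (i : Fin n) : EventuallyQuadratic fun k => ∑ α ∈ truncateFiber M β k, (α i : ℤ) := by
  refine ⟨0, 0, 0, β.degree + 1, fun k hk => ?_⟩
  beta_reduce
  rw [Finset.sum_eq_zero]
  · simp
  · intro α hα
    obtain ⟨hα, h⟩ := mem_truncateFiber.1 hα
    rw [truncate_eq_iff fun i => (hβ i).le] at h
    have : α = β := by
      ext j
      exact (h j).2 (hβ j).ne
    subst this
    omega

end Quadratic

/-! ### Existence of `h^I` and `Q_1^I` -/

section Existence

variable {K : Type*} [Field K] {d : ℕ} {I : Ideal (MvPolynomial (Fin (d + 1)) K)}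

/-- Standardness depends only on the truncation, so the sum splits over the finitely many standard
`β` in the box `[0, M]^(d+1)`. It remains to see that each `β` attains the cap at no more than two
indices. -/
theorem IsMonomialInitialIdeal.eventuallyQuadratic_standardSum
    (hI : IsMonomialInitialIdeal (rationalNormalCurveIdeal K d) I) (i : Fin (d + 1)) :
    EventuallyQuadratic fun k => standardSum I k i := by
  classical
  obtain ⟨M, hM⟩ := hI.isMonomialIdeal.exists_truncate
  set B : Finset (Fin (d + 1) →₀ ℕ) :=
    (Finset.Iic (Finsupp.equivFunOnFinite.symm fun _ => M)).filter
      fun β => monomial β (1 : K) ∉ I with hB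
  have hBM : ∀ {β}, β ∈ B ↔ (∀ i, β i ≤ M) ∧ monomial β (1 : K) ∉ I := by
    intro β
    rw [hB, Finset.mem_filter, Finset.mem_Iic]
    rfl
  have hsum : (fun k => standardSum I k i) =
      fun k => ∑ β ∈ B, ∑ α ∈ truncateFiber M β k, (α i : ℤ) := by
    ext k
    rw [standardSum, ← Finset.sum_fiberwise_of_maps_to (t := B) (g := truncate M)]
    · refine Finset.sum_congr rfl fun β hβ => Finset.sum_congr ?_ fun _ _ => rfl
      ext α
      rw [Finset.mem_filter, mem_standardExponents, mem_truncateFiber]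
      constructor
      · rintro ⟨⟨h, -⟩, h'⟩
        exact ⟨h, h'⟩
      · rintro ⟨h, rfl⟩
        exact ⟨⟨h, fun hm => (hBM.1 hβ).2 ((hM α).1 hm)⟩, rfl⟩
    · intro α hα
      exact hBM.2 ⟨fun j => by simp, fun hm => (mem_standardExponents.1 hα).2 ((hM α).2 hm)⟩
  rw [hsum]
  refine EventuallyQuadratic.sum B fun β hβ => ?_
  obtain ⟨hβM, hβI⟩ := hBM.1 hβ
  -- Raising entries that are already at the cap keeps the truncation, so it cannot lead into `I`.
  have hpair : ∀ c e, β c = M → β e = M → X c * X e ∉ I.radical := by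
    rintro c e hc he ⟨N, hN⟩
    rw [X_mul_X_pow_eq] at hN
    have h1 := monomial_mem_of_le hN
      (le_add_of_nonneg_left bot_le : _ ≤ β + (Finsupp.single c N + Finsupp.single e N))
    rw [hM, (truncate_eq_iff hβM).2] at h1
    · exact hβI h1
    · intro j
      refine ⟨by simp, fun hj => ?_⟩
      have h1 : j ≠ c := by rintro rfl; exact hj hc
      have h2 : j ≠ e := by rintro rfl; exact hj he
      simp [h1, h2]
  set F : Finset (Fin (d + 1)) := Finset.univ.filter fun j => β j = M with hF
  have hmem : ∀ {j}, j ∈ F ↔ β j = M := by simp [hF]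
  rcases F.eq_empty_or_nonempty with h0 | h0
  · refine eventuallyQuadratic_truncateFiber_of_lt (fun j => lt_of_le_of_ne (hβM j) fun h => ?_) i
    have := hmem.2 h
    simp [h0] at this
  · refine eventuallyQuadratic_truncateFiber hβM (c := F.min' h0) (e := F.max' h0)
      (fun j hj => ?_) (hmem.1 (F.min'_mem h0)) (hmem.1 (F.max'_mem h0)) i
    -- A third capped index strictly between the extreme ones would put their product in the
    -- radical.
    by_contra! hne
    have hj' := hmem.2 hj
    exact hpair _ _ (hmem.1 (F.min'_mem h0)) (hmem.1 (F.max'_mem h0))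
      (hI.X_mul_X_mem_radical (lt_of_le_of_ne (F.min'_le j hj') hne.1.symm)
        (lt_of_le_of_ne (F.le_max' j hj') hne.2)
        fun h => hpair j j hj hj (Ideal.mul_mem_left _ _ h))

/-- Multiplication by `(1 - z)^3` takes third differences of the coefficients, which vanish on an
eventually quadratic sequence. -/
theorem IsMonomialInitialIdeal.exists_isHPolynomial
    (hI : IsMonomialInitialIdeal (rationalNormalCurveIdeal K d) I) : ∃ h, IsHPolynomial I h := by
  choose N hN using fun i => (hI.eventuallyQuadratic_standardSum i).exists_third_difference
  set L := ∑ i, N i with hL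
  have hNL : ∀ i, N i ≤ L := fun i => Finset.single_le_sum (by simp) (Finset.mem_univ i)
  set f := (1 - PowerSeries.X) ^ 3 * hilbertOneSeries I with hf
  have hvanish : ∀ k, PowerSeries.coeff (k + L + 3) f = 0 := by
    intro k
    have hexp : f = hilbertOneSeries I - 3 * (PowerSeries.X * hilbertOneSeries I) +
        3 * (PowerSeries.X ^ 2 * hilbertOneSeries I) - PowerSeries.X ^ 3 * hilbertOneSeries I := by
      rw [hf]
      ring
    have h3 : (3 : PowerSeries (MvPolynomial (Fin (d + 1)) ℤ)) = PowerSeries.C 3 :=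
      (map_ofNat _ 3).symm
    rw [hexp, h3, map_sub, map_add, map_sub, PowerSeries.coeff_C_mul, PowerSeries.coeff_C_mul,
      show k + L + 3 = (k + L + 2) + 1 from rfl, PowerSeries.coeff_succ_X_mul,
      show k + L + 2 + 1 = (k + L + 1) + 2 from rfl, PowerSeries.coeff_X_pow_mul,
      show k + L + 1 + 2 = (k + L) + 3 from rfl, PowerSeries.coeff_X_pow_mul]
    simp only [coeff_hilbertOneSeries, Finset.mul_sum, ← Finset.sum_sub_distrib,
      ← Finset.sum_add_distrib]
    refine Finset.sum_eq_zero fun i _ => ?_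
    have h := congrArg (C : ℤ → MvPolynomial (Fin (d + 1)) ℤ)
      (hN i (k + L + 1) (by have := hNL i; omega))
    simp only [map_sub, map_add, map_mul, map_zero] at h
    have h3' : (C 3 : MvPolynomial (Fin (d + 1)) ℤ) = 3 := map_ofNat _ 3
    rw [h3'] at h
    linear_combination X i * h
  refine ⟨PowerSeries.trunc (L + 3) f, ?_⟩
  rw [IsHPolynomial, ← hf]
  ext1 k
  rw [Polynomial.coeff_coe, PowerSeries.coeff_trunc]
  split_ifs with hk
  · rfl
  · obtain ⟨m, rfl⟩ := Nat.exists_eq_add_of_le (not_lt.1 hk)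
    rw [show L + 3 + m = m + L + 3 by omega, hvanish]

theorem IsMonomialInitialIdeal.exists_isHilbertPolynomialOne
    (hI : IsMonomialInitialIdeal (rationalNormalCurveIdeal K d) I) :
    ∃ Q, IsHilbertPolynomialOne I Q := by
  choose a b c N hN using fun i => hI.eventuallyQuadratic_standardSum i
  have hNL : ∀ i, N i ≤ ∑ i, N i := fun i => Finset.single_le_sum (by simp) (Finset.mem_univ i)
  -- The argument is `X + 1` because the coefficient of `z^k` comes from exponents of degree `k +
  -- 1`; the halves undo the factor `2` in `EventuallyQuadratic`.
  refine ⟨∑ i, (Polynomial.C (C ((a i : ℚ) / 2)) +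
    Polynomial.C (C ((b i : ℚ) / 2)) * (Polynomial.X + 1) +
    Polynomial.C (C ((c i : ℚ) / 2)) * (Polynomial.X + 1) ^ 2) * Polynomial.C (X i),
    ∑ i, N i, fun k hk => ?_⟩
  rw [coeff_hilbertOneSeries, Polynomial.eval_finsetSum, map_sum]
  refine Finset.sum_congr rfl fun i _ => ?_
  have h := hN i (k + 1) (by have := hNL i; omega)
  have h' : (standardSum I (k + 1) i : ℚ) =
      a i / 2 + b i / 2 * (k + 1) + c i / 2 * (k + 1) ^ 2 := by
    have := congrArg (Int.cast : ℤ → ℚ) h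
    push_cast at this
    linear_combination this / 2
  rw [map_mul, map_C, map_X, eq_intCast, h']
  simp

end Existence

end RNC

end

theorem mainTheorem10 {K : Type*} [Field K] (d : ℕ) (hd : 1 ≤ d)
    (I J : Ideal (MvPolynomial (Fin (d + 1)) K))
    (hI : RNC.IsMonomialInitialIdeal (RNC.rationalNormalCurveIdeal K d) I)
    (hJ : RNC.IsMonomialInitialIdeal (RNC.rationalNormalCurveIdeal K d) J) :
    -- the linear forms `e_0`
    (RNC.e0 I = RNC.e0 J ↔ I.radical = J.radical) ∧
    -- the polynomials `h` exist, are unique, and determine the ideal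
    (∃! h, RNC.IsHPolynomial I h) ∧ (∃! h, RNC.IsHPolynomial J h) ∧
    (∀ pI pJ, RNC.IsHPolynomial I pI → RNC.IsHPolynomial J pJ → (pI = pJ ↔ I = J)) ∧
    -- the polynomials `Q_1` exist, are unique, and determine the saturation
    (∃! Q, RNC.IsHilbertPolynomialOne I Q) ∧ (∃! Q, RNC.IsHilbertPolynomialOne J Q) ∧
    (∀ QI QJ, RNC.IsHilbertPolynomialOne I QI → RNC.IsHilbertPolynomialOne J QJ →
      (QI = QJ ↔ RNC.saturation I = RNC.saturation J)) ∧
    (RNC.saturation I = RNC.saturation J ↔ RNC.AgreeInLargeDegrees I J) := by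
  refine ⟨hI.e0_eq_iff hd hJ, ?_, ?_, fun pI pJ hp hq => ?_, ?_, ?_, fun QI QJ hP hQ => ?_,
    hI.isMonomialIdeal.saturation_eq_iff hJ.isMonomialIdeal⟩
  · obtain ⟨h, hh⟩ := hI.exists_isHPolynomial
    exact ⟨h, hh, fun p hp => (hp.eq_iff hh).2 rfl⟩
  · obtain ⟨h, hh⟩ := hJ.exists_isHPolynomial
    exact ⟨h, hh, fun p hp => (hp.eq_iff hh).2 rfl⟩
  · rw [hp.eq_iff hq]
    exact ⟨hI.eq_of_hilbertOneSeries_eq hd hJ, fun h => h ▸ rfl⟩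
  · obtain ⟨Q, hQ⟩ := hI.exists_isHilbertPolynomialOne
    exact ⟨Q, hQ, fun P hP => (hP.eq_iff hQ).2 ⟨0, fun _ _ => rfl⟩⟩
  · obtain ⟨Q, hQ⟩ := hJ.exists_isHilbertPolynomialOne
    exact ⟨Q, hQ, fun P hP => (hP.eq_iff hQ).2 ⟨0, fun _ _ => rfl⟩⟩
  · rw [hP.eq_iff hQ, hI.isMonomialIdeal.saturation_eq_iff hJ.isMonomialIdeal,
      hI.agreeInLargeDegrees_iff_coeff hd hJ]
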